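/- Let $(\Gamma_t)_{t\ge 0}$ be a standard Gamma process on a probability space $(\Omega,P)$: $\Gamma_0=0$ a.s., the increments are independent, $\Gamma_t-\Gamma_s$ has the Gamma law with shape $t-s$ and rate $1$ for $0\le s<t$, and almost all paths are nondecreasing and right-continuous. For a function $f\ge 0$ on $[0,\infty)$ that is integrable on every $[0,t]$ and not almost everywhere zero, write $$\lambda_t f=\int_0^t f(x)\,dx,\qquad \Gamma_t f=\int_{(0,t]} f\,d\Gamma \ \text{ (pathwise Lebesgue--Stieltjes integral)},$$ $$v_t(f)=\frac{\lambda_t(f^2)}{(\lambda_t f)^2},\qquad b_t(f)=\frac{f(t)}{\lambda_t f},\qquad R_t(f)=\frac{\Gamma_t f}{\lambda_t f},$$ where the quotients are considered for all $t$ so large that $\lambda_tf>0$. Define the following classes of such functions $f$, all limits being taken as $t\to\infty$: * $\mathcal V$: $f$ is locally square integrable on $[0,\infty)$ and $v_t(f)\to 0$; * $\mathcal B$: $b_t(f)\to 0$; * $\mathrm{OD}$ (orderly divergence in probability): $\lambda_t f\to\infty$ and $R_t(f)\to 1$ in probability. **Lemma.** Each of the classes $\mathcal V$, $\mathcal B$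 and $\mathrm{OD}$ is closed under multiplication by constants $c>0$ and under sums: if $f,g$ belong to the class, so do $cf$ and $f+g$. The same holds for the subclass of those $f\in\mathcal B$ with $\lambda_t f\to\infty$. -/

import Mathlib

open Set Filter Topology MeasureTheory ProbabilityTheory
open scoped NNReal ENNReal

noncomputable section

namespace OrderlyDivergence

/-! ### Integrands on the half-line and their numerical characteristics

An integrand on `[0, ∞)` is a function `f : ℝ → ℝ` of which only the values on `[0, ∞)` matter. -/

/-- `λ_t f = ∫_0^t f(x) dx`. -/
def lam (f : ℝ → ℝ) (t : ℝ) : ℝ := ∫ x in Ioc 0 t, f x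

/-- `v_t = λ_t(f²) / (λ_t f)²`. -/
def vRatio (f : ℝ → ℝ) (t : ℝ) : ℝ := lam (fun x => f x ^ 2) t / lam f t ^ 2

/-- `b_t = f(t) / λ_t f`. -/
def bRatio (f : ℝ → ℝ) (t : ℝ) : ℝ := f t / lam f t

/-- Positive, locally integrable functions on `[0, ∞)` that are not almost everywhere zero
(so that division by `λ_t f` makes sense for all large `t`). -/
structure IsIntegrand (f : ℝ → ℝ) : Prop where
  nonneg : ∀ x, 0 ≤ x → 0 ≤ f x
  locallyIntegrable : ∀ t, IntegrableOn f (Ioc 0 t)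
  nontrivial : ∃ t, 0 < lam f t

/-- The integrands with `λ_t f → ∞`. -/
def Divergent : Set (ℝ → ℝ) := {f | IsIntegrand f ∧ Tendsto (lam f) atTop atTop}

/-- The class `𝒱`: locally square integrable integrands with `v_t → 0`. -/
def ClassV : Set (ℝ → ℝ) :=
  {f | IsIntegrand f ∧ (∀ t, IntegrableOn (fun x => f x ^ 2) (Ioc 0 t)) ∧
    Tendsto (vRatio f) atTop (𝓝 0)}

/-- The class `ℬ`: integrands with `b_t → 0`. -/
def ClassB : Set (ℝ → ℝ) := {f | IsIntegrand f ∧ Tendsto (bRatio f) atTop (𝓝 0)}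

/-! ### The Gamma process and the pathwise integral -/

/-- A nondecreasing right-continuous path. -/
def IsGoodPath (γ : ℝ≥0 → ℝ) : Prop :=
  Monotone γ ∧ ∀ t, ContinuousWithinAt γ (Ici t) t

/-- A good path, extended by the constant `γ 0` to the negative axis, as a Stieltjes function. -/
def pathStieltjes (γ : ℝ≥0 → ℝ) (h : IsGoodPath γ) : StieltjesFunction ℝ where
  toFun x := γ x.toNNReal
  mono' _ _ hxy := h.1 (Real.toNNReal_mono hxy)
  right_continuous' x :=
    (h.2 x.toNNReal).comp (continuous_real_toNNReal.continuousWithinAt)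
      (fun _ hy => Real.toNNReal_mono hy)

open Classical in
/-- The Lebesgue–Stieltjes measure `dγ` of a path, with mass `γ b - γ a` on `(a, b]` for
`0 ≤ a ≤ b`. (It is set to `0` on the null set of paths that are not good.) -/
def pathMeasure (γ : ℝ≥0 → ℝ) : Measure ℝ :=
  if h : IsGoodPath γ then (pathStieltjes γ h).measure else 0

/-- `Γ` is a standard Gamma process on `(Ω, P)`: it starts at `0`, has independent increments,
`Γ_t - Γ_s` has the Gamma law with shape `t - s` and rate `1` for `s < t`, and almost all its paths
are nondecreasing and right-continuous. In particular `Γ_1` is exponential with mean `1`. -/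
structure IsGammaProcess {Ω : Type*} [MeasurableSpace Ω] (P : Measure Ω) (Γ : ℝ≥0 → Ω → ℝ) :
    Prop where
  zero : ∀ᵐ ω ∂P, Γ 0 ω = 0
  indep : HasIndepIncrements Γ P
  law : ∀ s t : ℝ≥0, s < t →
    HasLaw (fun ω => Γ t ω - Γ s ω) (gammaMeasure ((t : ℝ) - (s : ℝ)) 1) P
  path : ∀ᵐ ω ∂P, IsGoodPath (fun t => Γ t ω)

/-- The pathwise Gamma integral `Γ_t f = ∫_0^t f dΓ`. -/
def gammaIntegral {Ω : Type*} (Γ : ℝ≥0 → Ω → ℝ) (f : ℝ → ℝ) (t : ℝ) (ω : Ω) : ℝ :=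
  ∫ x in Ioc 0 t, f x ∂(pathMeasure (fun s => Γ s ω))

/-- The class OD (orderly divergence in probability): integrands with `λ_t f → ∞` such that
`R_t = Γ_t f / λ_t f → 1` in probability as `t → ∞`. -/
def ClassOD {Ω : Type*} [MeasurableSpace Ω] (P : Measure Ω) (Γ : ℝ≥0 → Ω → ℝ) : Set (ℝ → ℝ) :=
  {f | f ∈ Divergent ∧
    TendstoInMeasure P (fun t ω => gammaIntegral Γ f t ω / lam f t) atTop (fun _ => (1 : ℝ))}

/-- Closedness of a class of functions under positive scaling and under sums. -/
def ClosedUnderScalingAndSums (C : Set (ℝ → ℝ)) : Prop :=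
  (∀ c : ℝ, 0 < c → ∀ f ∈ C, (fun x => c * f x) ∈ C) ∧
    ∀ f ∈ C, ∀ g ∈ C, (fun x => f x + g x) ∈ C

end OrderlyDivergence

end

/-!
The ratios `v` and `b` of a sum are bounded by the ratios of the summands, because enlarging a
denominator only helps: `v_t(f + g) ≤ 2 (v_t(f) + v_t(g))` and `b_t(f + g) ≤ b_t(f) + b_t(g)`.
For OD, `(Γ_t f + Γ_t g) / (λ_t f + λ_t g)` is a convex combination of `R_t(f)` and `R_t(g)`, so it
is within `ε` of `1` as soon as both of them are. What remains is that `Γ_t (f + g)` really is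
`Γ_t f + Γ_t g` almost surely. The random measure `dΓ` gives mean mass `b - a` to `(a, b]`, so its
intensity is Lebesgue measure, and a Lebesgue integrable function is almost surely
`dΓ`-integrable.
-/

namespace OrderlyDivergence

section Integrands

variable {f g : ℝ → ℝ} {c t : ℝ}

lemma lam_const_mul (c : ℝ) (f : ℝ → ℝ) (t : ℝ) : lam (fun x => c * f x) t = c * lam f t :=
  integral_const_mul _ _

lemma lam_add (hf : IntegrableOn f (Ioc 0 t)) (hg : IntegrableOn g (Ioc 0 t)) :
    lam (fun x => f x + g x) t = lam f t + lam g t :=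
  integral_add hf hg

lemma lam_sq_nonneg (f : ℝ → ℝ) (t : ℝ) : 0 ≤ lam (fun x => f x ^ 2) t :=
  integral_nonneg fun _ => sq_nonneg _

lemma lam_add_sq_le (hf : MemLp f 2 (volume.restrict (Ioc 0 t)))
    (hg : MemLp g 2 (volume.restrict (Ioc 0 t))) :
    lam (fun x => (f x + g x) ^ 2) t ≤
      2 * (lam (fun x => f x ^ 2) t + lam (fun x => g x ^ 2) t) := by
  rw [← lam_add hf.integrable_sq hg.integrable_sq, ← lam_const_mul]
  exact integral_mono (hf.add hg).integrable_sq
    ((hf.integrable_sq.add hg.integrable_sq).const_mul 2) fun x => add_sq_le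

namespace IsIntegrand

lemma lam_nonneg (hf : IsIntegrand f) (t : ℝ) : 0 ≤ lam f t :=
  setIntegral_nonneg measurableSet_Ioc fun x hx => hf.nonneg x hx.1.le

lemma lam_mono (hf : IsIntegrand f) : Monotone (lam f) := fun _ t hst =>
  setIntegral_mono_set (hf.locallyIntegrable t)
    (ae_restrict_of_forall_mem measurableSet_Ioc fun x hx => hf.nonneg x hx.1.le)
    (Ioc_subset_Ioc_right hst).eventuallyLE

lemma eventually_lam_pos (hf : IsIntegrand f) : ∀ᶠ t in atTop, 0 < lam f t := by
  obtain ⟨t₀, ht₀⟩ := hf.nontrivial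
  filter_upwards [eventually_ge_atTop t₀] with t ht using ht₀.trans_le (hf.lam_mono ht)

lemma const_mul (hf : IsIntegrand f) (hc : 0 < c) : IsIntegrand fun x => c * f x where
  nonneg x hx := mul_nonneg hc.le (hf.nonneg x hx)
  locallyIntegrable t := (hf.locallyIntegrable t).const_mul c
  nontrivial := hf.nontrivial.imp fun t ht => (lam_const_mul c f t).symm ▸ mul_pos hc ht

lemma lam_add (hf : IsIntegrand f) (hg : IsIntegrand g) (t : ℝ) :
    lam (fun x => f x + g x) t = lam f t + lam g t :=
  OrderlyDivergence.lam_add (hf.locallyIntegrable t) (hg.locallyIntegrable t)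

lemma add (hf : IsIntegrand f) (hg : IsIntegrand g) : IsIntegrand fun x => f x + g x where
  nonneg x hx := add_nonneg (hf.nonneg x hx) (hg.nonneg x hx)
  locallyIntegrable t := (hf.locallyIntegrable t).add (hg.locallyIntegrable t)
  nontrivial := hf.nontrivial.imp fun t ht =>
    (hf.lam_add hg t).symm ▸ add_pos_of_pos_of_nonneg ht (hg.lam_nonneg t)

lemma memLp_two (hf : IsIntegrand f) (hf2 : IntegrableOn (fun x => f x ^ 2) (Ioc 0 t)) :
    MemLp f 2 (volume.restrict (Ioc 0 t)) :=
  (memLp_two_iff_integrable_sq (hf.locallyIntegrable t).aestronglyMeasurable).2 hf2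

end IsIntegrand

lemma vRatio_nonneg (f : ℝ → ℝ) (t : ℝ) : 0 ≤ vRatio f t :=
  div_nonneg (lam_sq_nonneg f t) (sq_nonneg _)

lemma vRatio_const_mul (hc : c ≠ 0) (f : ℝ → ℝ) : vRatio (fun x => c * f x) = vRatio f := by
  ext t
  simp only [vRatio, mul_pow, lam_const_mul]
  exact mul_div_mul_left _ _ (pow_ne_zero 2 hc)

lemma vRatio_add_le (hf : MemLp f 2 (volume.restrict (Ioc 0 t)))
    (hg : MemLp g 2 (volume.restrict (Ioc 0 t))) (hft : 0 < lam f t) (hgt : 0 < lam g t) :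
    vRatio (fun x => f x + g x) t ≤ 2 * (vRatio f t + vRatio g t) := by
  have hf2 := lam_sq_nonneg f t
  have hg2 := lam_sq_nonneg g t
  have hlam := lam_add (hf.integrable one_le_two) (hg.integrable one_le_two)
  calc vRatio (fun x => f x + g x) t
      ≤ 2 * (lam (fun x => f x ^ 2) t + lam (fun x => g x ^ 2) t) / (lam f t + lam g t) ^ 2 := by
        rw [vRatio, hlam]
        gcongr
        exact lam_add_sq_le hf hg
    _ = 2 * (lam (fun x => f x ^ 2) t / (lam f t + lam g t) ^ 2 +
          lam (fun x => g x ^ 2) t / (lam f t + lam g t) ^ 2) := by ring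
    _ ≤ 2 * (vRatio f t + vRatio g t) := by
        unfold vRatio
        gcongr
        · exact le_add_of_nonneg_right hgt.le
        · exact le_add_of_nonneg_left hft.le

lemma IsIntegrand.bRatio_nonneg (hf : IsIntegrand f) (ht : 0 ≤ t) : 0 ≤ bRatio f t :=
  div_nonneg (hf.nonneg t ht) (hf.lam_nonneg t)

lemma bRatio_const_mul (hc : c ≠ 0) (f : ℝ → ℝ) : bRatio (fun x => c * f x) = bRatio f := by
  ext t
  simp only [bRatio, lam_const_mul]
  exact mul_div_mul_left _ _ hc

lemma IsIntegrand.bRatio_add_le (hf : IsIntegrand f) (hg : IsIntegrand g) (ht : 0 ≤ t)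
    (hft : 0 < lam f t) (hgt : 0 < lam g t) :
    bRatio (fun x => f x + g x) t ≤ bRatio f t + bRatio g t := by
  rw [bRatio, hf.lam_add hg, add_div]
  exact add_le_add
    (div_le_div_of_nonneg_left (hf.nonneg t ht) hft (le_add_of_nonneg_right hgt.le))
    (div_le_div_of_nonneg_left (hg.nonneg t ht) hgt (le_add_of_nonneg_left hft.le))

end Integrands

theorem closedUnderScalingAndSums_classV : ClosedUnderScalingAndSums ClassV := by
  constructor
  · rintro c hc f ⟨hf, hf2, hfv⟩
    refine ⟨hf.const_mul hc, fun t => ?_, (vRatio_const_mul hc.ne' f).symm ▸ hfv⟩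
    simp only [mul_pow]
    exact (hf2 t).const_mul (c ^ 2)
  · rintro f ⟨hf, hf2, hfv⟩ g ⟨hg, hg2, hgv⟩
    have hfLp (t : ℝ) := hf.memLp_two (hf2 t)
    have hgLp (t : ℝ) := hg.memLp_two (hg2 t)
    have hbound : Tendsto (fun t => 2 * (vRatio f t + vRatio g t)) atTop (𝓝 0) := by
      simpa using (hfv.add hgv).const_mul 2
    refine ⟨hf.add hg, fun t => ((hfLp t).add (hgLp t)).integrable_sq,
      squeeze_zero' (.of_forall fun t => vRatio_nonneg _ t) ?_ hbound⟩
    filter_upwards [hf.eventually_lam_pos, hg.eventually_lam_pos] with t hft hgt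
    exact vRatio_add_le (hfLp t) (hgLp t) hft hgt

theorem closedUnderScalingAndSums_classB : ClosedUnderScalingAndSums ClassB := by
  constructor
  · rintro c hc f ⟨hf, hfb⟩
    exact ⟨hf.const_mul hc, (bRatio_const_mul hc.ne' f).symm ▸ hfb⟩
  · rintro f ⟨hf, hfb⟩ g ⟨hg, hgb⟩
    have hbound : Tendsto (fun t => bRatio f t + bRatio g t) atTop (𝓝 0) := by
      simpa using hfb.add hgb
    refine ⟨hf.add hg, squeeze_zero' ?_ ?_ hbound⟩
    · filter_upwards [eventually_ge_atTop 0] with t ht using (hf.add hg).bRatio_nonneg ht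
    · filter_upwards [eventually_ge_atTop 0, hf.eventually_lam_pos, hg.eventually_lam_pos]
        with t ht hft hgt using hf.bRatio_add_le hg ht hft hgt

theorem closedUnderScalingAndSums_divergent : ClosedUnderScalingAndSums Divergent := by
  constructor
  · rintro c hc f ⟨hf, hf_top⟩
    exact ⟨hf.const_mul hc, (hf_top.const_mul_atTop hc).congr fun t => (lam_const_mul c f t).symm⟩
  · rintro f ⟨hf, hf_top⟩ g ⟨hg, hg_top⟩
    exact ⟨hf.add hg, (hf_top.atTop_add_atTop hg_top).congr fun t => (hf.lam_add hg t).symm⟩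

lemma ClosedUnderScalingAndSums.inter {C D : Set (ℝ → ℝ)} (hC : ClosedUnderScalingAndSums C)
    (hD : ClosedUnderScalingAndSums D) : ClosedUnderScalingAndSums (C ∩ D) :=
  ⟨fun c hc f hf => ⟨hC.1 c hc f hf.1, hD.1 c hc f hf.2⟩,
    fun f hf g hg => ⟨hC.2 f hf.1 g hg.1, hD.2 f hf.2 g hg.2⟩⟩

lemma lintegral_completion {α : Type*} [MeasurableSpace α] {μ : Measure α} {f : α → ℝ≥0∞}
    (hf : AEMeasurable f μ) :
    ∫⁻ x : NullMeasurableSpace α μ, f x ∂μ.completion = ∫⁻ x, f x ∂μ := by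
  have hmeas : @Measurable (NullMeasurableSpace α μ) α _ _ id := fun _ hs => hs.nullMeasurableSet
  have hpres : @MeasurePreserving (NullMeasurableSpace α μ) α _ _ id μ.completion μ :=
    ⟨hmeas, Measure.ext fun _ hs => Measure.map_apply hmeas hs⟩
  conv_rhs => rw [← hpres.map_eq]
  exact (lintegral_map' (hpres.map_eq.symm ▸ hf) hpres.aemeasurable).symm

lemma ae_integrable_of_integrable_bind {α β E : Type*} [MeasurableSpace α] [MeasurableSpace β]
    [NormedAddCommGroup E] {μ : Measure α} {κ : α → Measure β} {f : β → E}
    (hκ : AEMeasurable κ μ) (hf : Integrable f (μ.bind κ)) : ∀ᵐ a ∂μ, Integrable f (κ a) := by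
  have hmeas : AEMeasurable (fun a => ∫⁻ x, ‖f x‖ₑ ∂κ a) μ :=
    (Measure.aemeasurable_lintegral hf.aestronglyMeasurable.enorm).comp_aemeasurable hκ
  have hfin : ∫⁻ a, ∫⁻ x, ‖f x‖ₑ ∂κ a ∂μ ≠ ∞ := by
    rw [← Measure.lintegral_bind hκ hf.aestronglyMeasurable.enorm]
    exact hf.hasFiniteIntegral.ne
  filter_upwards [Measure.ae_ae_of_ae_bind hκ hf.aestronglyMeasurable.ae_eq_mk,
    ae_lt_top' hmeas hfin] with a ha_mk ha_fin
  exact ⟨⟨_, hf.aestronglyMeasurable.stronglyMeasurable_mk, ha_mk⟩, ha_fin⟩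

lemma gammaPDF_mul_ofReal {a r : ℝ} (ha : 0 < a) (hr : 0 < r) (x : ℝ) :
    gammaPDF a r x * ENNReal.ofReal x = ENNReal.ofReal (a / r) * gammaPDF (a + 1) r x := by
  rcases lt_trichotomy x 0 with hx | rfl | hx
  · simp [gammaPDF_of_neg hx]
  · simp [gammaPDF_of_nonneg, Real.zero_rpow ha.ne']
  · rw [gammaPDF_of_nonneg hx.le, gammaPDF_of_nonneg hx.le, ← ENNReal.ofReal_mul' hx.le,
      ← ENNReal.ofReal_mul (div_pos ha hr).le, Real.Gamma_add_one ha.ne', add_sub_cancel_right,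
      Real.rpow_sub_one hx.ne', Real.rpow_add_one hr.ne']
    have hGamma := (Real.Gamma_pos_of_pos ha).ne'
    congr 1
    field_simp

lemma lintegral_ofReal_gammaMeasure {a r : ℝ} (ha : 0 < a) (hr : 0 < r) :
    ∫⁻ x, ENNReal.ofReal x ∂gammaMeasure a r = ENNReal.ofReal (a / r) := by
  have hpdf (b : ℝ) : Measurable (gammaPDF b r) := (measurable_gammaPDFReal b r).ennreal_ofReal
  calc ∫⁻ x, ENNReal.ofReal x ∂gammaMeasure a r
      = ∫⁻ x, gammaPDF a r x * ENNReal.ofReal x :=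
        lintegral_withDensity_eq_lintegral_mul _ (hpdf a) ENNReal.measurable_ofReal
    _ = ENNReal.ofReal (a / r) * ∫⁻ x, gammaPDF (a + 1) r x := by
        simp only [gammaPDF_mul_ofReal ha hr, lintegral_const_mul _ (hpdf (a + 1))]
    _ = ENNReal.ofReal (a / r) := by
        rw [lintegral_gammaPDF_eq_one (add_pos ha one_pos) hr, mul_one]

/-- An increasing process of unit mean rate: `E[Γ_t - Γ_s] = t - s` and almost all paths are
nondecreasing and right-continuous. The mean is taken of the positive part, with values in `ℝ≥0∞`,
which is the mean of the increment itself because paths are almost surely nondecreasing. -/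
structure IsUnitRateProcess {Ω : Type*} [MeasurableSpace Ω] (P : Measure Ω) (Γ : ℝ≥0 → Ω → ℝ) :
    Prop where
  path : ∀ᵐ ω ∂P, IsGoodPath (fun t => Γ t ω)
  aemeasurable_sub : ∀ s t : ℝ≥0, s < t → AEMeasurable (fun ω => Γ t ω - Γ s ω) P
  lintegral_sub : ∀ s t : ℝ≥0, s < t →
    ∫⁻ ω, ENNReal.ofReal (Γ t ω - Γ s ω) ∂P = ENNReal.ofReal (t - s)

lemma IsGammaProcess.isUnitRateProcess {Ω : Type*} [MeasurableSpace Ω] {P : Measure Ω}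
    {Γ : ℝ≥0 → Ω → ℝ} (hΓ : IsGammaProcess P Γ) : IsUnitRateProcess P Γ where
  path := hΓ.path
  aemeasurable_sub s t hst := (hΓ.law s t hst).aemeasurable
  lintegral_sub s t hst := by
    have hpos : (0 : ℝ) < t - s := sub_pos.2 (NNReal.coe_lt_coe.2 hst)
    rw [(hΓ.law s t hst).lintegral_comp ENNReal.measurable_ofReal.aemeasurable,
      lintegral_ofReal_gammaMeasure hpos one_pos, div_one]

instance isLocallyFiniteMeasure_pathMeasure (γ : ℝ≥0 → ℝ) :
    IsLocallyFiniteMeasure (pathMeasure γ) := by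
  unfold pathMeasure
  split_ifs <;> infer_instance

lemma pathMeasure_Ioc {γ : ℝ≥0 → ℝ} (h : IsGoodPath γ) (s t : ℝ≥0) :
    pathMeasure γ (Ioc s t) = ENNReal.ofReal (γ t - γ s) := by
  simp [pathMeasure, h, StieltjesFunction.measure_Ioc, pathStieltjes]

/-- The random measure `dΓ` on `(0, t]`. It is a function on the completion of `(Ω, P)`, where it
is measurable: its masses are only `P`-almost everywhere equal to measurable functions, and the
exceptional null sets depend on the interval. -/
noncomputable def truncatedPathMeasure {Ω : Type*} [MeasurableSpace Ω] (P : Measure Ω)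
    (Γ : ℝ≥0 → Ω → ℝ) (t : ℝ) (ω : NullMeasurableSpace Ω P) : Measure ℝ :=
  (pathMeasure fun s => Γ s ω).restrict (Ioc 0 t)

lemma gammaIntegral_const_mul {Ω : Type*} (Γ : ℝ≥0 → Ω → ℝ) (c : ℝ) (f : ℝ → ℝ)
    (t : ℝ) (ω : Ω) :
    gammaIntegral Γ (fun x => c * f x) t ω = c * gammaIntegral Γ f t ω :=
  integral_const_mul _ _

section UnitRate

variable {Ω : Type*} [MeasurableSpace Ω] {P : Measure Ω} {Γ : ℝ≥0 → Ω → ℝ}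

instance isFiniteMeasure_truncatedPathMeasure (t : ℝ) (ω : NullMeasurableSpace Ω P) :
    IsFiniteMeasure (truncatedPathMeasure P Γ t ω) :=
  isFiniteMeasure_restrict.2 measure_Ioc_lt_top.ne

lemma truncatedPathMeasure_Ioc (t a b : ℝ) (ω : NullMeasurableSpace Ω P) :
    truncatedPathMeasure P Γ t ω (Ioc a b) =
      pathMeasure (fun s => Γ s ω) (Ioc (max a 0) (min b t)) := by
  rw [truncatedPathMeasure, Measure.restrict_apply measurableSet_Ioc, Ioc_inter_Ioc]

namespace IsUnitRateProcess

lemma ae_pathMeasure_Ioc (hΓ : IsUnitRateProcess P Γ) (s t : ℝ≥0) :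
    (fun ω => pathMeasure (fun u => Γ u ω) (Ioc s t)) =ᵐ[P]
      fun ω => ENNReal.ofReal (Γ t ω - Γ s ω) :=
  hΓ.path.mono fun _ hω => pathMeasure_Ioc hω s t

lemma aemeasurable_pathMeasure_Ioc (hΓ : IsUnitRateProcess P Γ) {a : ℝ} (ha : 0 ≤ a) (b : ℝ) :
    AEMeasurable (fun ω => pathMeasure (fun s => Γ s ω) (Ioc a b)) P := by
  rcases le_or_gt b a with hba | hab
  · simp [Ioc_eq_empty hba.not_gt]
  · lift b to ℝ≥0 using ha.trans hab.le
    lift a to ℝ≥0 using ha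
    exact (hΓ.aemeasurable_sub a b (mod_cast hab)).ennreal_ofReal.congr
      (hΓ.ae_pathMeasure_Ioc a b).symm

lemma lintegral_pathMeasure_Ioc (hΓ : IsUnitRateProcess P Γ) {a : ℝ} (ha : 0 ≤ a) (b : ℝ) :
    ∫⁻ ω, pathMeasure (fun s => Γ s ω) (Ioc a b) ∂P = volume (Ioc a b) := by
  rcases le_or_gt b a with hba | hab
  · simp [Ioc_eq_empty hba.not_gt]
  · lift b to ℝ≥0 using ha.trans hab.le
    lift a to ℝ≥0 using ha
    rw [lintegral_congr_ae (hΓ.ae_pathMeasure_Ioc a b), hΓ.lintegral_sub a b (mod_cast hab),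
      Real.volume_Ioc]

lemma measurable_truncatedPathMeasure (hΓ : IsUnitRateProcess P Γ) (t : ℝ) :
    Measurable (truncatedPathMeasure P Γ t) := by
  refine Measurable.measure_of_isPiSystem
    (BorelSpace.measurable_eq.trans (borel_eq_generateFrom_Ioc ℝ)) (isPiSystem_Ioc id id) ?_ ?_
  · rintro _ ⟨a, b, -, rfl⟩
    simp only [truncatedPathMeasure_Ioc]
    exact (hΓ.aemeasurable_pathMeasure_Ioc (le_max_right a 0) _).nullMeasurable
  · simp only [truncatedPathMeasure, Measure.restrict_apply_univ]
    exact (hΓ.aemeasurable_pathMeasure_Ioc le_rfl t).nullMeasurable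

lemma bind_truncatedPathMeasure (hΓ : IsUnitRateProcess P Γ) (t : ℝ) :
    P.completion.bind (truncatedPathMeasure P Γ t) = volume.restrict (Ioc 0 t) := by
  refine (Measure.ext_of_Ioc _ _ fun a b _ => ?_).symm
  rw [Measure.bind_apply measurableSet_Ioc (hΓ.measurable_truncatedPathMeasure t).aemeasurable]
  simp only [truncatedPathMeasure_Ioc]
  rw [lintegral_completion (hΓ.aemeasurable_pathMeasure_Ioc (le_max_right a 0) _),
    hΓ.lintegral_pathMeasure_Ioc (le_max_right a 0), Measure.restrict_apply measurableSet_Ioc,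
    Ioc_inter_Ioc]

lemma ae_integrableOn_pathMeasure (hΓ : IsUnitRateProcess P Γ) {E : Type*} [NormedAddCommGroup E]
    {f : ℝ → E} {t : ℝ} (hf : IntegrableOn f (Ioc 0 t)) :
    ∀ᵐ ω ∂P, IntegrableOn f (Ioc 0 t) (pathMeasure fun s => Γ s ω) := by
  rw [IntegrableOn, ← hΓ.bind_truncatedPathMeasure t] at hf
  have hae := ae_integrable_of_integrable_bind
    (hΓ.measurable_truncatedPathMeasure t).aemeasurable hf
  rwa [Measure.ae_completion] at hae

lemma gammaIntegral_add_ae_eq (hΓ : IsUnitRateProcess P Γ) {f g : ℝ → ℝ} {t : ℝ}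
    (hf : IntegrableOn f (Ioc 0 t)) (hg : IntegrableOn g (Ioc 0 t)) :
    gammaIntegral Γ (fun x => f x + g x) t =ᵐ[P] gammaIntegral Γ f t + gammaIntegral Γ g t := by
  filter_upwards [hΓ.ae_integrableOn_pathMeasure hf, hΓ.ae_integrableOn_pathMeasure hg]
    with ω hfω hgω using integral_add hfω hgω

end IsUnitRateProcess

end UnitRate

lemma mediant_mem_of_convex {s : Set ℝ} (hs : Convex ℝ s) {x y a b : ℝ} (ha : 0 < a) (hb : 0 < b)
    (hx : x / a ∈ s) (hy : y / b ∈ s) : (x + y) / (a + b) ∈ s := by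
  have hmediant : (x + y) / (a + b) = (a / (a + b)) • (x / a) + (b / (a + b)) • (y / b) := by
    simp only [smul_eq_mul]
    field_simp
  rw [hmediant]
  exact hs hx hy (by positivity) (by positivity) (by field_simp)

lemma tendstoInMeasure_mediant {Ω ι : Type*} [MeasurableSpace Ω] {μ : Measure Ω} {l : Filter ι}
    {X Y : ι → Ω → ℝ} {a b : ι → ℝ} {Z : Ω → ℝ} (ha : ∀ᶠ i in l, 0 < a i)
    (hb : ∀ᶠ i in l, 0 < b i) (hX : TendstoInMeasure μ (fun i ω => X i ω / a i) l Z)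
    (hY : TendstoInMeasure μ (fun i ω => Y i ω / b i) l Z) :
    TendstoInMeasure μ (fun i ω => (X i ω + Y i ω) / (a i + b i)) l Z := by
  rw [tendstoInMeasure_iff_dist] at hX hY ⊢
  intro ε hε
  have hbound := (hX ε hε).add (hY ε hε)
  rw [add_zero] at hbound
  refine tendsto_of_tendsto_of_tendsto_of_le_of_le' tendsto_const_nhds hbound
    (.of_forall fun _ => zero_le) ?_
  filter_upwards [ha, hb] with i hai hbi
  refine (measure_mono fun ω hω => ?_).trans (measure_union_le _ _)
  contrapose! hω
  obtain ⟨hXnear, hYnear⟩ := not_or.1 hω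
  exact not_le.2 <| Metric.mem_ball.1 <| mediant_mem_of_convex (convex_ball (Z ω) ε) hai hbi
    (Metric.mem_ball.2 (not_le.1 hXnear)) (Metric.mem_ball.2 (not_le.1 hYnear))

theorem IsUnitRateProcess.closedUnderScalingAndSums_classOD {Ω : Type*} [MeasurableSpace Ω]
    {P : Measure Ω} {Γ : ℝ≥0 → Ω → ℝ} (hΓ : IsUnitRateProcess P Γ) :
    ClosedUnderScalingAndSums (ClassOD P Γ) := by
  constructor
  · rintro c hc f ⟨hf, hfR⟩
    refine ⟨closedUnderScalingAndSums_divergent.1 c hc f hf, ?_⟩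
    simpa only [gammaIntegral_const_mul, lam_const_mul, mul_div_mul_left _ _ hc.ne'] using hfR
  · rintro f ⟨hf, hfR⟩ g ⟨hg, hgR⟩
    refine ⟨closedUnderScalingAndSums_divergent.2 f hf g hg,
      (tendstoInMeasure_mediant hf.1.eventually_lam_pos hg.1.eventually_lam_pos hfR hgR).congr_left
        fun t => ?_⟩
    filter_upwards [hΓ.gammaIntegral_add_ae_eq (hf.1.locallyIntegrable t)
      (hg.1.locallyIntegrable t)] with ω hω
    rw [hω, hf.1.lam_add hg.1, Pi.add_apply]

end OrderlyDivergence

theorem mainTheorem9_general :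
    OrderlyDivergence.ClosedUnderScalingAndSums OrderlyDivergence.ClassV ∧
    OrderlyDivergence.ClosedUnderScalingAndSums OrderlyDivergence.ClassB ∧
    OrderlyDivergence.ClosedUnderScalingAndSums
      (OrderlyDivergence.ClassB ∩ OrderlyDivergence.Divergent) ∧
    ∀ (Ω : Type*) [MeasurableSpace Ω] (P : Measure Ω) (Γ : ℝ≥0 → Ω → ℝ),
      OrderlyDivergence.IsUnitRateProcess P Γ →
      OrderlyDivergence.ClosedUnderScalingAndSums (OrderlyDivergence.ClassOD P Γ) :=
  ⟨OrderlyDivergence.closedUnderScalingAndSums_classV,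
    OrderlyDivergence.closedUnderScalingAndSums_classB,
    OrderlyDivergence.closedUnderScalingAndSums_classB.inter
      OrderlyDivergence.closedUnderScalingAndSums_divergent,
    fun _ _ _ _ hΓ => hΓ.closedUnderScalingAndSums_classOD⟩

theorem mainTheorem9 :
    OrderlyDivergence.ClosedUnderScalingAndSums OrderlyDivergence.ClassV ∧
    OrderlyDivergence.ClosedUnderScalingAndSums OrderlyDivergence.ClassB ∧
    OrderlyDivergence.ClosedUnderScalingAndSums
      (OrderlyDivergence.ClassB ∩ OrderlyDivergence.Divergent) ∧
    ∀ (Ω : Type*) [MeasurableSpace Ω] (P : Measure Ω) [IsProbabilityMeasure P]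
      (Γ : ℝ≥0 → Ω → ℝ), OrderlyDivergence.IsGammaProcess P Γ →
      OrderlyDivergence.ClosedUnderScalingAndSums (OrderlyDivergence.ClassOD P Γ) :=
  let ⟨hV, hB, hBDiv, hOD⟩ := mainTheorem9_general
  ⟨hV, hB, hBDiv, fun Ω _ P _ Γ hΓ => hOD Ω P Γ hΓ.isUnitRateProcess⟩
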